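/- Let $k\ge 1$ be an integer, $\mathbb R^k_+=\{x\in\mathbb R^k : x_i\ge 0 \text{ for all } i\}$ and $\mathbb R^k_{++}=\{x\in\mathbb R^k : x_i>0 \text{ for all } i\}$; all operations on vectors are componentwise. A function $\mu:\mathbb R^k_{++}\to\mathbb R$ is called multiplicative if $\mu(xy)=\mu(x)\mu(y)$, additive if $\mu(x+y)=\mu(x)+\mu(y)$, and a projection if it is both multiplicative and additive; $l:\mathbb R^k_{++}\to\mathbb R$ is called logarithmic if $l(xy)=l(x)+l(y)$ (each for all $x,y\in\mathbb R^k_{++}$). Let $\mu:\mathbb R^k_{++}\to\mathbb R$ be multiplicative and let $f:\mathbb R^k_+\times\mathbb R^k_+\times\mathbb R^k_+\to\mathbb R$ be symmetric (invariant under all permutations of its three arguments) and satisfy the modified entropy equation $$f(x,y,z)=f(x,y+z,0)+\mu(y+z)\,f\!\left(0,\frac{y}{y+z},\frac{z}{y+z}\right)\qquad (x,y,z\in\mathbb R^k_{++}).$$ Assume that $f$ is continuous on $(\mathbb R^k_{++})^3$, or, alternatively, only that $(x,y)\mapsto f(0,x,y)$ is continuous on $(\mathbb R^k_{++})^2$.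 Then: 1. If $\mu$ is a projection, there exist a continuous logarithmic function $l:\mathbb R^k_{++}\to\mathbb R$, that is, a function of the form $l(x)=\sum_{i=1}^k c_i\ln x_i$ with real constants $c_i$ (possibly $0$), and a continuous function $\psi_1:\mathbb R^k_{++}\to\mathbb R$ such that for all $x,y,z\in\mathbb R^k_{++}$ $$f(x,y,z)=\mu(x)l(x)+\mu(y)l(y)+\mu(z)l(z)+\psi_1(x+y+z).$$ 2. If $\mu\equiv 1$, there exists a continuous function $\psi_2:\mathbb R^k_{++}\to\mathbb R$ such that $f(x,y,z)=\psi_2(x+y+z)$ for all $x,y,z\in\mathbb R^k_{++}$. 3. In all other cases there exist a continuous function $\psi_3:\mathbb R^k_{++}\to\mathbb R$ and a constant $b\in\mathbb R$ such that for all $x,y,z\in\mathbb R^k_{++}$ $$f(x,y,z)=b\bigl(\mu(x)+\mu(y)+\mu(z)\bigr)+\psi_3(x+y+z).$$ -/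

import Mathlib

namespace ModifiedEntropy

/-- The closed positive cone of `ℝ^k`: all coordinates are nonnegative. -/
def nonnegCone (k : ℕ) : Set (Fin k → ℝ) := {x | ∀ i, 0 ≤ x i}

/-- The open positive cone of `ℝ^k`: all coordinates are positive. -/
def posCone (k : ℕ) : Set (Fin k → ℝ) := {x | ∀ i, 0 < x i}

/-- `a` is additive on the open positive cone. -/
def IsAdditive {k : ℕ} (a : (Fin k → ℝ) → ℝ) : Prop :=
  ∀ x ∈ posCone k, ∀ y ∈ posCone k, a (x + y) = a x + a y

/-- `μ` is multiplicative on the open positive cone (vectors are multiplied componentwise). -/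
def IsMultiplicative {k : ℕ} (μ : (Fin k → ℝ) → ℝ) : Prop :=
  ∀ x ∈ posCone k, ∀ y ∈ posCone k, μ (x * y) = μ x * μ y

/-- `l` is logarithmic on the open positive cone (vectors are multiplied componentwise). -/
def IsLogarithmic {k : ℕ} (l : (Fin k → ℝ) → ℝ) : Prop :=
  ∀ x ∈ posCone k, ∀ y ∈ posCone k, l (x * y) = l x + l y

/-- `μ` is a projection: both additive and multiplicative on the open positive cone. -/
def IsProjection {k : ℕ} (μ : (Fin k → ℝ) → ℝ) : Prop :=
  IsAdditive μ ∧ IsMultiplicative μ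

/-- `f` is a symmetric function of its three arguments in the closed positive cone:
it is invariant under two transpositions that generate all permutations. -/
def IsSymmetric {k : ℕ} (f : (Fin k → ℝ) → (Fin k → ℝ) → (Fin k → ℝ) → ℝ) : Prop :=
  ∀ x ∈ nonnegCone k, ∀ y ∈ nonnegCone k, ∀ z ∈ nonnegCone k,
    f x y z = f y x z ∧ f x y z = f x z y

/-- The modified entropy equation for all `x, y, z` in the open positive cone
(division of vectors is componentwise). -/
def ModifiedEntropyEquation {k : ℕ} (μ : (Fin k → ℝ) → ℝ)
    (f : (Fin k → ℝ) → (Fin k → ℝ) → (Fin k → ℝ) → ℝ) : Prop :=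
  ∀ x ∈ posCone k, ∀ y ∈ posCone k, ∀ z ∈ posCone k,
    f x y z = f x (y + z) 0 + μ (y + z) * f 0 (y / (y + z)) (z / (y + z))

end ModifiedEntropy

/-! Put H(x,y) = μ(x+y) f(0, x/(x+y), y/(x+y)). The equation and the symmetry of f give f(x,y,z) =
f(0,x,y+z) + H(y,z). Comparing two groupings of x+y+z = 1 and rescaling, H is a symmetric cocycle,
homogeneous in the sense H(tx,ty) = μ(t)H(x,y). Once H(x,y) = w(x)+w(y)-w(x+y), symmetry forces
f(x,y,z)-w(x)-w(y)-w(z) to depend on x+y+z alone (`exists_sum_representation`), so it remains to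
find w.

If μ is not additive, algebra suffices: the cocycle identity on x, sx, y, sy, together with
homogeneity, makes H a multiple of the Cauchy difference of μ
(`exists_entropyCocycle_eq_of_not_isAdditive`). Continuity of bμ is then read off from f. The case μ
≡ 1 belongs here, with bμ absorbed into ψ.

If μ is a projection, it is zero (and H = 0) or a coordinate x_i. In the latter case H is
continuous, and integration gives a continuous w (`exists_eq_coboundary_posCone`). Homogeneity makes
w(tx) - t_i w(x) additive, hence linear in x; comparing the orders of two dilations gives w = x_i
L(x) + linear with L logarithmic (`exists_logarithmic_of_dilation`), and the linear term has zero
Cauchy difference. -/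

namespace ModifiedEntropy

open Set MeasureTheory

/-! ### Algebra of symmetric cocycles -/

/-- A symmetric real-valued 2-cocycle on the additive semigroup `C`. -/
structure IsSymmCocycleOn {E : Type*} [Add E] (C : Set E) (H : E → E → ℝ) : Prop where
  symm : ∀ x ∈ C, ∀ y ∈ C, H x y = H y x
  assoc : ∀ x ∈ C, ∀ y ∈ C, ∀ z ∈ C, H (x + y) z + H x y = H x (y + z) + H y z

/-- The coboundary (Cauchy difference) of `φ`. -/
def coboundary {E : Type*} [Add E] (φ : E → ℝ) (x y : E) : ℝ := φ x + φ y - φ (x + y)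

theorem IsSymmCocycleOn.sub_coboundary {E : Type*} [AddCommSemigroup E] {C : Set E}
    {H : E → E → ℝ} (hH : IsSymmCocycleOn C H) (φ : E → ℝ) :
    IsSymmCocycleOn C (fun x y => H x y - coboundary φ x y) where
  symm x hx y hy := by
    simp only [coboundary, hH.symm x hx y hy, add_comm x y]; ring
  assoc x hx y hy z hz := by
    have := hH.assoc x hx y hy z hz
    simp only [coboundary, add_assoc]; linarith

/-- Each side is the total cocycle value of summing a, b, c, d in pairs; associativity and symmetry
make it independent of the pairing. -/
theorem IsSymmCocycleOn.four_term {E : Type*} [AddCommSemigroup E] {C : Set E}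
    (hadd : ∀ x ∈ C, ∀ y ∈ C, x + y ∈ C)
    {H : E → E → ℝ} (hH : IsSymmCocycleOn C H) {a b c d : E}
    (ha : a ∈ C) (hb : b ∈ C) (hc : c ∈ C) (hd : d ∈ C) :
    H a b + H c d + H (a + b) (c + d) = H a c + H b d + H (a + c) (b + d) := by
  have h1 := hH.assoc a ha b hb (c + d) (hadd c hc d hd)
  have h2 := hH.assoc b hb c hc d hd
  have h3 := hH.assoc a ha c hc (b + d) (hadd b hb d hd)
  have h4 := hH.assoc c hc b hb d hd
  have h5 := hH.symm b hb c hc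
  have h6 : b + (c + d) = c + (b + d) := add_left_comm b c d
  rw [h6] at h1
  rw [add_comm b c] at h2
  linarith

/-! ### Trivialising a continuous cocycle along one direction -/

theorem continuousOn_intervalIntegral_param {X : Type*} [TopologicalSpace X] {C : Set X}
    {F : X → ℝ → ℝ} {a b : ℝ} (hab : a ≤ b)
    (hF : ContinuousOn (fun p : X × ℝ => F p.1 p.2) (C ×ˢ Icc a b)) :
    ContinuousOn (fun u => ∫ r in a..b, F u r) C := by
  rw [continuousOn_iff_continuous_domRestrict]
  have hc : Continuous (Function.uncurry fun (u : C) (r : ℝ) => F u (projIcc a b hab r)) := by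
    have : Continuous fun p : C × ℝ => ((p.1 : X), (projIcc a b hab p.2 : ℝ)) := by fun_prop
    exact hF.comp_continuous this fun p => ⟨p.1.2, (projIcc a b hab p.2).2⟩
  refine (intervalIntegral.continuous_parametric_intervalIntegral_of_continuous' (μ := volume) hc a b).congr ?_
  intro u
  refine intervalIntegral.integral_congr fun r hr => ?_
  rw [uIcc_of_le hab] at hr
  simp [projIcc_of_mem hab hr]

/-- Subtracting a coboundary makes a continuous symmetric cocycle invariant under translations
in a given direction. -/
theorem exists_sub_coboundary_translation_invariant {E : Type*} [TopologicalSpace E]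
    [AddCommGroup E] [Module ℝ E] [ContinuousAdd E] [ContinuousSMul ℝ E] {C : Set E} {v : E}
    {m : E → ℝ} (hadd : ∀ x ∈ C, ∀ y ∈ C, x + y ∈ C) (hv : ∀ s : ℝ, 0 < s → s • v ∈ C)
    (hm : ContinuousOn m C) (hmv : ∀ u ∈ C, ∀ s : ℝ, 0 ≤ s → m (u + s • v) = m u + s)
    (hseg : ∀ u ∈ C, ∀ r : ℝ, min (1 - m u) 1 ≤ r → u + r • v ∈ C)
    {H : E → E → ℝ} (hH : IsSymmCocycleOn C H)
    (hcont : ContinuousOn (fun p : E × E => H p.1 p.2) (C ×ˢ C)) :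
    ∃ φ : E → ℝ, ContinuousOn φ C ∧
      (∀ x ∈ C, ∀ y ∈ C, ∀ s : ℝ, 0 ≤ s →
        H x (y + s • v) - coboundary φ x (y + s • v) = H x y - coboundary φ x y) ∧
      ∀ w : E, (∀ u ∈ C, m (u + w) = m u) → (∀ x ∈ C, x + w ∈ C) →
        (∀ x ∈ C, ∀ y ∈ C, H (x + w) y = H x y) → ∀ u ∈ C, φ (u + w) = φ u := by
  have hv1 : v ∈ C := by simpa using hv 1 one_pos
  have hpos : ∀ u ∈ C, ∀ s : ℝ, 0 ≤ s → u + s • v ∈ C := by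
    intro u hu s hs
    rcases hs.eq_or_lt with rfl | hs
    · simpa using hu
    · exact hadd u hu _ (hv s hs)
  -- Integrating the cocycle identity for x, y, rv over r replaces H(x,y), up to Φ(y) - Φ(x+y), by
  -- the average of H(x, y+rv). The window [1,2] avoids r = 0, where rv need not lie in C.
  set Φ : E → ℝ := fun x => ∫ r in (1 : ℝ)..2, H x (r • v) with hΦ
  -- A primitive of H(·,v) along lines parallel to v, based at the slice m = 1. Rescaling to fixed
  -- limits makes its continuity in u visible and covers negative m(u).
  set K : E → ℝ := fun u => m u * ∫ r in (0 : ℝ)..1, H (u + (1 - m u * r) • v) v with hK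
  have hKeq : ∀ u, K u = ∫ r in (1 - m u)..1, H (u + r • v) v := by
    intro u
    have := intervalIntegral.mul_integral_comp_sub_mul (a := 0) (b := 1)
      (f := fun r : ℝ => H (u + r • v) v) (c := m u) (d := 1)
    simpa [hK] using this
  have hmem : ∀ u ∈ C, ∀ r ∈ Icc (0 : ℝ) 1, u + (1 - m u * r) • v ∈ C := by
    intro u hu r hr
    refine hseg u hu _ ?_
    rcases le_total 0 (m u) with h | h
    · exact (min_le_left _ _).trans (by nlinarith [hr.1, hr.2])
    · exact (min_le_right _ _).trans (by nlinarith [hr.1, hr.2])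
  have hΦc : ContinuousOn Φ C := by
    refine continuousOn_intervalIntegral_param one_le_two ?_
    refine hcont.comp (f := fun p : E × ℝ => (p.1, p.2 • v)) (by fun_prop) ?_
    intro p hp
    exact ⟨hp.1, hv _ (by linarith [hp.2.1])⟩
  have hKc : ContinuousOn K C := by
    refine hm.mul (continuousOn_intervalIntegral_param zero_le_one ?_)
    have hm' : ContinuousOn (fun p : E × ℝ => m p.1) (C ×ˢ Icc (0 : ℝ) 1) :=
      hm.comp continuousOn_fst fun p hp => hp.1
    refine hcont.comp (f := fun p : E × ℝ => (p.1 + (1 - m p.1 * p.2) • v, v)) ?_ ?_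
    · exact (continuousOn_fst.add ((continuousOn_const.sub (hm'.mul continuousOn_snd)).smul
        continuousOn_const)).prodMk continuousOn_const
    · intro p hp
      exact ⟨hmem _ hp.1 _ hp.2, hv1⟩
  have hline : ∀ u ∈ C, ∀ a b : ℝ, min (1 - m u) 1 ≤ a → min (1 - m u) 1 ≤ b →
      IntervalIntegrable (fun r : ℝ => H (u + r • v) v) volume a b := by
    intro u hu a b ha hb
    refine ContinuousOn.intervalIntegrable ?_
    refine hcont.comp (f := fun r : ℝ => (u + r • v, v)) (by fun_prop) ?_
    intro r hr
    exact ⟨hseg u hu r ((le_min ha hb).trans hr.1), hv1⟩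
  have hline' : ∀ x ∈ C, ∀ y ∈ C, ∀ a b : ℝ, 0 ≤ a → 0 ≤ b →
      IntervalIntegrable (fun r : ℝ => H x (y + r • v)) volume a b := by
    intro x hx y hy a b ha hb
    refine ContinuousOn.intervalIntegrable ?_
    refine hcont.comp (f := fun r : ℝ => (x, y + r • v)) (by fun_prop) ?_
    intro r hr
    exact ⟨hx, hpos y hy r ((le_min ha hb).trans hr.1)⟩
  have hKs : ∀ u ∈ C, ∀ s : ℝ, 0 ≤ s →
      K (u + s • v) - K u = ∫ r in (1 : ℝ)..(1 + s), H (u + r • v) v := by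
    intro u hu s hs
    rw [hKeq, hKeq, hmv u hu s hs]
    have h1 : ∫ r in (1 - (m u + s))..1, H (u + s • v + r • v) v
        = ∫ r in (1 - m u)..(1 + s), H (u + r • v) v := by
      have := intervalIntegral.integral_comp_add_right (a := 1 - (m u + s)) (b := 1)
        (fun r : ℝ => H (u + r • v) v) s
      rw [show 1 - (m u + s) + s = 1 - m u by ring] at this
      rw [← this]
      refine intervalIntegral.integral_congr fun r _ => ?_
      simp only [add_smul, add_assoc, add_comm (s • v)]
    rw [h1, intervalIntegral.integral_interval_sub_left]
    · exact hline u hu _ _ (min_le_left _ _) ((min_le_right _ _).trans (by linarith))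
    · exact hline u hu _ _ (min_le_left _ _) (min_le_right _ _)
  have hN : ∀ x ∈ C, ∀ y ∈ C,
      H x y = Φ y - Φ (x + y) + ∫ r in (1 : ℝ)..2, H x (y + r • v) := by
    intro x hx y hy
    have hint : ∀ z ∈ C, IntervalIntegrable (fun r : ℝ => H z (r • v)) volume 1 2 := by
      intro z hz
      refine ContinuousOn.intervalIntegrable ?_
      refine hcont.comp (f := fun r : ℝ => (z, r • v)) (by fun_prop) ?_
      intro r hr
      rw [uIcc_of_le one_le_two] at hr
      exact ⟨hz, hv r (by linarith [hr.1])⟩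
    have h1 : ∫ r in (1 : ℝ)..2, H x (y + r • v)
        = ∫ r in (1 : ℝ)..2, (H (x + y) (r • v) + H x y - H y (r • v)) := by
      refine intervalIntegral.integral_congr fun r hr => ?_
      rw [uIcc_of_le one_le_two] at hr
      have := hH.assoc x hx y hy (r • v) (hv r (by linarith [hr.1]))
      linarith
    rw [h1, intervalIntegral.integral_sub
      ((hint _ (hadd x hx y hy)).add intervalIntegrable_const) (hint y hy),
      intervalIntegral.integral_add (hint _ (hadd x hx y hy)) intervalIntegrable_const,
      intervalIntegral.integral_const]
    simp only [hΦ, smul_eq_mul]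
    ring
  refine ⟨fun x => Φ x - K x, hΦc.sub hKc, ?_, ?_⟩
  · intro x hx y hy s hs
    have hys := hpos y hy s hs
    have e1 := hN x hx y hy
    have e2 := hN x hx _ hys
    have k1 := hKs y hy s hs
    have k2 := hKs (x + y) (hadd x hx y hy) s hs
    have h3 : ∫ r in (1 : ℝ)..2, H x (y + s • v + r • v)
        = ∫ r in (1 + s)..(2 + s), H x (y + r • v) := by
      rw [← intervalIntegral.integral_comp_add_right (fun r : ℝ => H x (y + r • v)) s]
      refine intervalIntegral.integral_congr fun r _ => ?_
      simp only [add_smul, add_assoc, add_comm (s • v)]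
    have h4 : (∫ r in (1 + s)..(2 + s), H x (y + r • v)) - ∫ r in (1 : ℝ)..2, H x (y + r • v)
        = (∫ r in (2 : ℝ)..(2 + s), H x (y + r • v)) - ∫ r in (1 : ℝ)..(1 + s), H x (y + r • v) := by
      have a1 := intervalIntegral.integral_add_adjacent_intervals
        (hline' x hx y hy 1 (1 + s) (by norm_num) (by linarith))
        (hline' x hx y hy (1 + s) (2 + s) (by linarith) (by linarith))
      have a2 := intervalIntegral.integral_add_adjacent_intervals
        (hline' x hx y hy 1 2 (by norm_num) (by norm_num))
        (hline' x hx y hy 2 (2 + s) (by norm_num) (by linarith))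
      linarith
    have h5 : ∫ r in (2 : ℝ)..(2 + s), H x (y + r • v)
        = ∫ r in (1 : ℝ)..(1 + s), H x (y + (r + 1) • v) := by
      rw [intervalIntegral.integral_comp_add_right (fun r : ℝ => H x (y + r • v)) 1]
      congr 1 <;> ring
    -- The cocycle identity with last argument v turns the unit-step difference of H(x,·) into
    -- values of H(·,v), whose integrals are increments of K.
    have h6 : ∫ r in (1 : ℝ)..(1 + s), H x (y + (r + 1) • v)
        = ∫ r in (1 : ℝ)..(1 + s),
          (H x (y + r • v) + H (x + y + r • v) v - H (y + r • v) v) := by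
      refine intervalIntegral.integral_congr fun r hr => ?_
      rw [uIcc_of_le (by linarith)] at hr
      have := hH.assoc x hx (y + r • v) (hpos y hy r (by linarith [hr.1])) v hv1
      simp only [add_smul, one_smul, ← add_assoc] at this ⊢
      linarith
    have i1 := hline' x hx y hy 1 (1 + s) (by norm_num) (by linarith)
    have i2 := hline y hy 1 (1 + s) (min_le_right _ _) ((min_le_right _ _).trans (by linarith))
    have i3 := hline (x + y) (hadd x hx y hy) 1 (1 + s) (min_le_right _ _)
      ((min_le_right _ _).trans (by linarith))
    rw [intervalIntegral.integral_sub (i1.add i3) i2, intervalIntegral.integral_add i1 i3] at h6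
    simp only [coboundary, ← add_assoc] at e2 ⊢
    linarith
  · intro w hmw hCw hHw u hu
    have hKw : K (u + w) = K u := by
      rw [hK]
      simp only
      rw [hmw u hu]
      congr 1
      refine intervalIntegral.integral_congr fun r hr => ?_
      rw [uIcc_of_le zero_le_one] at hr
      rw [add_right_comm]
      exact hHw _ (hmem u hu r hr) v hv1
    have hΦw : Φ (u + w) = Φ u := by
      refine intervalIntegral.integral_congr fun r hr => ?_
      rw [uIcc_of_le one_le_two] at hr
      exact hHw u hu _ (hv r (by linarith [hr.1]))
    simp only [hKw, hΦw]

/-! ### Coboundaries on the whole space and on the open cone -/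

theorem exists_sub_coboundary_invariant_coords {k : ℕ} {H : (Fin k → ℝ) → (Fin k → ℝ) → ℝ}
    (hH : IsSymmCocycleOn univ H)
    (hc : Continuous fun p : (Fin k → ℝ) × (Fin k → ℝ) => H p.1 p.2) (S : Finset (Fin k)) :
    ∃ φ : (Fin k → ℝ) → ℝ, Continuous φ ∧ ∀ j ∈ S, ∀ x y : Fin k → ℝ, ∀ s : ℝ,
      H x (y + s • Pi.single j 1) - coboundary φ x (y + s • Pi.single j 1)
        = H x y - coboundary φ x y := by
  induction S using Finset.induction_on with
  | empty => exact ⟨0, continuous_const, by simp⟩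
  | insert a S ha ih =>
    obtain ⟨φ, hφ, hinv⟩ := ih
    have hH1 := hH.sub_coboundary φ
    obtain ⟨ψ, hψ, hψv, hψw⟩ := exists_sub_coboundary_translation_invariant (C := univ)
      (v := Pi.single a 1) (m := fun u : Fin k → ℝ => u a) (fun _ _ _ _ => mem_univ _)
      (fun _ _ => mem_univ _) (by fun_prop) (by simp) (fun _ _ _ _ => mem_univ _) hH1
      (by simp only [coboundary]; fun_prop)
    have hadd : ∀ x y, coboundary (fun u => φ u + ψ u) x y
        = coboundary φ x y + coboundary ψ x y := by
      intro x y; simp only [coboundary]; ring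
    refine ⟨fun u => φ u + ψ u, hφ.add (continuousOn_univ.1 hψ), ?_⟩
    intro j hj x y s
    simp only [hadd]
    rcases Finset.mem_insert.1 hj with rfl | hj
    · rcases le_total 0 s with hs | hs
      · linarith [hψv x trivial y trivial s hs]
      · have := hψv x trivial (y + s • Pi.single j 1) trivial (-s) (by linarith)
        rw [neg_smul, add_neg_cancel_right] at this
        linarith
    -- Invariance already gained in direction j survives, because the new correction ψ is itself
    -- invariant under shifts along j.
    · have hja : a ≠ j := by rintro rfl; exact ha hj
      have hsymm := hH1.symm
      have hw := hψw (s • Pi.single j 1) (by simp [hja]) (fun _ _ => mem_univ _) (by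
        intro x _ y _
        rw [hsymm _ trivial _ trivial, hinv j hj, hsymm _ trivial _ trivial])
      have h1 := hinv j hj x y s
      have h2 : coboundary ψ x (y + s • Pi.single j 1) = coboundary ψ x y := by
        simp only [coboundary, ← add_assoc, hw _ trivial]
      linarith

/-- Continuous symmetric real cocycles on `ℝ^k` are coboundaries of continuous functions. -/
theorem exists_eq_coboundary {k : ℕ} {H : (Fin k → ℝ) → (Fin k → ℝ) → ℝ}
    (hH : IsSymmCocycleOn univ H)
    (hc : Continuous fun p : (Fin k → ℝ) × (Fin k → ℝ) => H p.1 p.2) :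
    ∃ φ : (Fin k → ℝ) → ℝ, Continuous φ ∧ ∀ x y, H x y = coboundary φ x y := by
  obtain ⟨φ, hφ, hinv⟩ := exists_sub_coboundary_invariant_coords hH hc Finset.univ
  have hsymm := (hH.sub_coboundary φ).symm
  have hsum : ∀ (S : Finset (Fin k)) (x y : Fin k → ℝ),
      H x (∑ j ∈ S, y j • Pi.single j (1 : ℝ)) -
        coboundary φ x (∑ j ∈ S, y j • Pi.single j (1 : ℝ)) = H x 0 - coboundary φ x 0 := by
    intro S x y
    induction S using Finset.induction_on with
    | empty => simp
    | insert a S ha ih =>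
      rw [Finset.sum_insert ha, add_comm, hinv a (Finset.mem_univ _), ih]
  have h0 : ∀ x y, H x y - coboundary φ x y = H x 0 - coboundary φ x 0 := by
    intro x y
    have h := hsum Finset.univ x y
    rwa [show ∑ j, y j • Pi.single j (1 : ℝ) = y by
      ext i; simp [Finset.sum_apply, Pi.single_apply]] at h
  -- What remains of H is a constant, and a constant function is its own Cauchy difference.
  refine ⟨fun u => φ u + (H 0 0 - coboundary φ 0 0), by fun_prop, fun x y => ?_⟩
  have h1 := h0 x y
  have h2 := hsymm x trivial 0 trivial
  have h3 := h0 0 x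
  simp only [coboundary] at *
  linarith

theorem add_mem_posCone {k : ℕ} {x y : Fin k → ℝ} (hx : x ∈ posCone k) (hy : y ∈ posCone k) :
    x + y ∈ posCone k := fun i => add_pos (hx i) (hy i)

theorem mul_mem_posCone {k : ℕ} {x y : Fin k → ℝ} (hx : x ∈ posCone k) (hy : y ∈ posCone k) :
    x * y ∈ posCone k := fun i => mul_pos (hx i) (hy i)

theorem div_mem_posCone {k : ℕ} {x y : Fin k → ℝ} (hx : x ∈ posCone k) (hy : y ∈ posCone k) :
    x / y ∈ posCone k := fun i => div_pos (hx i) (hy i)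

theorem one_mem_posCone {k : ℕ} : (1 : Fin k → ℝ) ∈ posCone k := fun _ => one_pos

theorem smul_mem_posCone {k : ℕ} {s : ℝ} (hs : 0 < s) {x : Fin k → ℝ} (hx : x ∈ posCone k) :
    s • x ∈ posCone k := fun i => mul_pos hs (hx i)

/-- Continuous symmetric real cocycles on the open positive cone are coboundaries of
continuous functions. -/
theorem exists_eq_coboundary_posCone {k : ℕ} (hk : 0 < k)
    {H : (Fin k → ℝ) → (Fin k → ℝ) → ℝ} (hH : IsSymmCocycleOn (posCone k) H)
    (hc : ContinuousOn (fun p : (Fin k → ℝ) × (Fin k → ℝ) => H p.1 p.2)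
      (posCone k ×ˢ posCone k)) :
    ∃ φ : (Fin k → ℝ) → ℝ, ContinuousOn φ (posCone k) ∧
      ∀ x ∈ posCone k, ∀ y ∈ posCone k, H x y = coboundary φ x y := by
  have hne : (Finset.univ : Finset (Fin k)).Nonempty := ⟨⟨0, hk⟩, Finset.mem_univ _⟩
  -- The smallest coordinate grows at unit speed along the all-ones vector, and its slice m = 1
  -- stays inside the open cone.
  set m : (Fin k → ℝ) → ℝ := fun u => Finset.univ.inf' hne u with hm
  have hmc : Continuous m := Continuous.finset_inf'_apply hne fun i _ => continuous_apply i
  have hmle : ∀ u i, m u ≤ u i := fun u i => Finset.inf'_le u (Finset.mem_univ i)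
  have hmpos : ∀ u ∈ posCone k, 0 < m u := fun u hu =>
    (Finset.lt_inf'_iff hne).2 fun i _ => hu i
  obtain ⟨φ, hφ, hinv, -⟩ := exists_sub_coboundary_translation_invariant (C := posCone k)
    (v := 1) (m := m) (fun x hx y hy => add_mem_posCone hx hy)
    (fun s hs => smul_mem_posCone hs one_mem_posCone) hmc.continuousOn
    (by
      intro u _ s _
      refine le_antisymm ?_ ((Finset.le_inf'_iff hne _).2 fun i _ => ?_)
      · obtain ⟨i, -, hi⟩ := Finset.exists_mem_eq_inf' hne u
        rw [hm]
        simp only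
        rw [hi]
        simpa [hm] using hmle (u + s • 1) i
      · simpa using hmle u i)
    (by
      intro u hu r hr i
      have h1 := hmle u i
      have h2 := hu i
      have : 0 < u i + r := by
        rcases min_le_iff.1 hr with h | h <;> linarith
      simpa using this) hH hc
  set H₁ : (Fin k → ℝ) → (Fin k → ℝ) → ℝ := fun x y => H x y - coboundary φ x y with hH₁
  have hH1 : IsSymmCocycleOn (posCone k) H₁ := hH.sub_coboundary φ
  have hright : ∀ x ∈ posCone k, ∀ y ∈ posCone k, ∀ y' ∈ posCone k, ∀ s : ℝ,
      y' = y + s • 1 → H₁ x y' = H₁ x y := by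
    rintro x hx y hy y' hy' s rfl
    rcases le_total 0 s with hs | hs
    · exact hinv x hx y hy s hs
    · have := hinv x hx _ hy' (-s) (by linarith)
      rw [neg_smul, add_neg_cancel_right] at this
      exact this.symm
  have hleft : ∀ x ∈ posCone k, ∀ y ∈ posCone k, ∀ x' ∈ posCone k, ∀ s : ℝ,
      x' = x + s • 1 → H₁ x' y = H₁ x y := by
    intro x hx y hy x' hx' s h
    rw [hH1.symm x' hx' y hy, hright y hy x hx x' hx' s h, hH1.symm x hx y hy]
  -- This shift pushes every vector into the cone and is additive up to multiples of the all-ones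
  -- vector, which `H₁` ignores. Hence `H₁` pulls back to a cocycle on all of ℝ^k.
  set p : (Fin k → ℝ) → (Fin k → ℝ) := fun x => x + (‖x‖ + 1) • 1 with hp
  have hpm : ∀ x, p x ∈ posCone k := by
    intro x i
    have := (abs_le.1 ((Real.norm_eq_abs (x i)) ▸ norm_le_pi_norm x i)).1
    simp [hp]
    linarith
  have hpc : Continuous p := by simp only [hp]; fun_prop
  have hpadd : ∀ x y, p (x + y) = p x + p y + (‖x + y‖ - ‖x‖ - ‖y‖ - 1) • 1 := by
    intro x y
    ext i
    simp [hp]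
    ring
  obtain ⟨ψ, hψ, hψH⟩ := exists_eq_coboundary (H := fun x y => H₁ (p x) (p y))
    { symm := fun x _ y _ => hH1.symm _ (hpm x) _ (hpm y)
      assoc := fun x _ y _ z _ => by
        have e1 := hleft _ (add_mem_posCone (hpm x) (hpm y)) _ (hpm z) _ (hpm (x + y)) _
          (hpadd x y)
        have e2 := hright _ (hpm x) _ (add_mem_posCone (hpm y) (hpm z)) _ (hpm (y + z)) _
          (hpadd y z)
        have := hH1.assoc _ (hpm x) _ (hpm y) _ (hpm z)
        simp only [e1, e2, this] }
    (by
      have h1 : ContinuousOn (fun q : (Fin k → ℝ) × (Fin k → ℝ) => H₁ q.1 q.2)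
          (posCone k ×ˢ posCone k) := by
        refine hc.sub ((?_ : ContinuousOn _ _).add ?_ |>.sub ?_)
        · exact hφ.comp continuousOn_fst fun q hq => hq.1
        · exact hφ.comp continuousOn_snd fun q hq => hq.2
        · exact hφ.comp (continuousOn_fst.add continuousOn_snd) fun q hq =>
            add_mem_posCone hq.1 hq.2
      exact h1.comp_continuous (f := fun q : (Fin k → ℝ) × (Fin k → ℝ) => (p q.1, p q.2))
        (by fun_prop) fun q => ⟨hpm _, hpm _⟩)
  refine ⟨fun x => φ x + ψ x, hφ.add hψ.continuousOn, fun x hx y hy => ?_⟩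
  have h1 := hψH x y
  have e1 := hleft x hx (p y) (hpm y) (p x) (hpm x) _ rfl
  have e2 := hright x hx y hy (p y) (hpm y) _ rfl
  simp only [e1, e2] at h1
  simp only [hH₁, coboundary] at h1 ⊢
  linarith

/-! ### Additive and logarithmic functions, projections, dilations -/

/-- An additive function on the open positive cone extends to an additive map on `ℝ^k`,
by writing a vector as a difference of two positive ones. -/
theorem IsAdditive.exists_extension {k : ℕ} {A : (Fin k → ℝ) → ℝ} (hA : IsAdditive A) :
    ∃ B : (Fin k → ℝ) →+ ℝ, (∀ x ∈ posCone k, B x = A x) ∧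
      (ContinuousOn A (posCone k) → Continuous B) := by
  set p : (Fin k → ℝ) → (Fin k → ℝ) := fun x i => max (x i) 0 + 1 with hp
  have hpm : ∀ x, p x ∈ posCone k := fun x i => by
    have := le_max_right (x i) 0
    simp only [hp]; linarith
  have hpc : Continuous p := by simp only [hp]; fun_prop
  have hmax : ∀ a : ℝ, max a 0 - max (-a) 0 = a := fun a => by
    rcases le_total 0 a with h | h
    · rw [max_eq_left h, max_eq_right (by linarith)]; ring
    · rw [max_eq_right h, max_eq_left (by linarith)]; ring
  have hdiff : ∀ x, p x = x + p (-x) := fun x => by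
    ext i
    have := hmax (x i)
    simp only [hp, Pi.add_apply, Pi.neg_apply]; linarith
  let B : (Fin k → ℝ) →+ ℝ := AddMonoidHom.mk' (fun x => A (p x) - A (p (-x))) (by
    intro x y
    have e : p (x + y) + (p (-x) + p (-y)) = p (-(x + y)) + (p x + p y) := by
      rw [hdiff (x + y), hdiff x, hdiff y]; abel
    have h := congrArg A e
    rw [hA _ (hpm _) _ (add_mem_posCone (hpm _) (hpm _)), hA _ (hpm _) _ (hpm _),
      hA _ (hpm _) _ (add_mem_posCone (hpm _) (hpm _)), hA _ (hpm _) _ (hpm _)] at h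
    linarith)
  refine ⟨B, fun x hx => ?_, fun hc => ?_⟩
  · change A (p x) - A (p (-x)) = A x
    rw [hdiff x, hA x hx _ (hpm _)]; ring
  · exact (hc.comp_continuous hpc hpm).sub (hc.comp_continuous (hpc.comp continuous_neg)
      fun x => hpm _)

theorem exists_coeff_of_continuous_addMonoidHom {k : ℕ} (B : (Fin k → ℝ) →+ ℝ)
    (hB : Continuous B) : ∃ a : Fin k → ℝ, ∀ x, B x = ∑ j, a j * x j := by
  refine ⟨fun j => B (Pi.single j 1), fun x => ?_⟩
  have h := (B.toRealLinearMap hB).toLinearMap.pi_apply_eq_sum_univ x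
  simp only [smul_eq_mul] at h
  refine h.trans (Finset.sum_congr rfl fun j _ => ?_)
  rw [mul_comm]
  congr 1
  change B _ = B _
  congr 1
  ext l
  simp [Pi.single_apply, eq_comm]

theorem IsAdditive.exists_coeff {k : ℕ} {A : (Fin k → ℝ) → ℝ} (hA : IsAdditive A)
    (hc : ContinuousOn A (posCone k)) :
    ∃ a : Fin k → ℝ, ∀ x ∈ posCone k, A x = ∑ j, a j * x j := by
  obtain ⟨B, hB, hBc⟩ := hA.exists_extension
  obtain ⟨a, ha⟩ := exists_coeff_of_continuous_addMonoidHom B (hBc hc)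
  exact ⟨a, fun x hx => by rw [← hB x hx, ha]⟩

theorem coeff_unique_on_posCone {k : ℕ} {a b : Fin k → ℝ}
    (h : ∀ x ∈ posCone k, ∑ j, a j * x j = ∑ j, b j * x j) (j : Fin k) : a j = b j := by
  have h1 := h 1 one_mem_posCone
  have h2 := h (1 + Pi.single j 1) fun i => by
    have : (0 : ℝ) ≤ (Pi.single j 1 : Fin k → ℝ) i := by
      rw [Pi.single_apply]; split_ifs <;> norm_num
    simp only [Pi.add_apply, Pi.one_apply]; linarith
  simp only [Pi.add_apply, Pi.one_apply, mul_add, mul_one, Finset.sum_add_distrib,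
    Pi.single_apply, mul_ite, mul_zero, Finset.sum_ite_eq', Finset.mem_univ, if_true] at h1 h2
  linarith

theorem IsLogarithmic.exists_coeff {k : ℕ} {l : (Fin k → ℝ) → ℝ} (hl : IsLogarithmic l)
    (hc : ContinuousOn l (posCone k)) :
    ∃ c : Fin k → ℝ, ∀ x ∈ posCone k, l x = ∑ i, c i * Real.log (x i) := by
  set e : (Fin k → ℝ) → (Fin k → ℝ) := fun v i => Real.exp (v i) with he
  have hem : ∀ v, e v ∈ posCone k := fun v i => Real.exp_pos _
  have hec : Continuous e := by simp only [he]; fun_prop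
  obtain ⟨c, h⟩ := exists_coeff_of_continuous_addMonoidHom
    (AddMonoidHom.mk' (fun v => l (e v)) (by
      intro v w
      rw [← hl _ (hem v) _ (hem w)]
      congr 1
      ext i
      simp [he, Real.exp_add])) (hc.comp_continuous hec hem)
  refine ⟨c, fun x hx => ?_⟩
  rw [← h fun i => Real.log (x i)]
  change l x = l _
  congr 1
  ext i
  exact (Real.exp_log (hx i)).symm

/-- A projection of the open positive cone vanishes or is a coordinate. -/
theorem IsProjection.eq_zero_or_eq_coord {k : ℕ} {μ : (Fin k → ℝ) → ℝ} (hμ : IsProjection μ) :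
    (∀ x ∈ posCone k, μ x = 0) ∨ ∃ i, ∀ x ∈ posCone k, μ x = x i := by
  obtain ⟨hadd, hmul⟩ := hμ
  by_cases h1 : μ 1 = 0
  · left
    intro x hx
    have := hmul 1 one_mem_posCone x hx
    rwa [h1, one_mul, zero_mul] at this
  right
  obtain ⟨B, hB, -⟩ := hadd.exists_extension
  have hB1 : B 1 = 1 := by
    have := hmul 1 one_mem_posCone 1 one_mem_posCone
    rw [mul_one] at this
    rw [hB 1 one_mem_posCone]
    exact (mul_right_cancel₀ h1 (by rw [one_mul]; exact this)).symm
  have hdecomp : ∀ x : Fin k → ℝ, ∃ p ∈ posCone k, ∃ q ∈ posCone k, x = p - q := by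
    intro x
    refine ⟨fun i => |x i| + 1 + x i, fun i => ?_, fun i => |x i| + 1, fun i => ?_, ?_⟩
    · linarith [neg_abs_le (x i)]
    · positivity
    · ext i; simp
  have hBmul : ∀ x y, B (x * y) = B x * B y := by
    have hpos : ∀ x ∈ posCone k, ∀ y ∈ posCone k, B (x * y) = B x * B y := fun x hx y hy => by
      rw [hB _ (mul_mem_posCone hx hy), hmul x hx y hy, hB x hx, hB y hy]
    intro x y
    obtain ⟨p, hp, q, hq, rfl⟩ := hdecomp x
    obtain ⟨r, hr, s, hs, rfl⟩ := hdecomp y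
    simp only [sub_mul, mul_sub, map_sub, hpos p hp r hr, hpos p hp s hs, hpos q hq r hr,
      hpos q hq s hs]
  let R : (Fin k → ℝ) →+* ℝ :=
    { toFun := B, map_one' := hB1, map_mul' := hBmul, map_zero' := B.map_zero,
      map_add' := B.map_add }
  -- The identity is the only ring endomorphism of ℝ, so no continuity of μ is needed.
  have hconst : ∀ r : ℝ, R (algebraMap ℝ (Fin k → ℝ) r) = r := fun r =>
    congrArg (fun g : ℝ →+* ℝ => g r)
      (Subsingleton.elim (R.comp (algebraMap ℝ (Fin k → ℝ))) (RingHom.id ℝ))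
  obtain ⟨i, hi⟩ : ∃ i, R (Pi.single i 1) ≠ 0 := by
    by_contra! h
    have h2 : R (∑ i, Pi.single i 1) = 0 := by rw [map_sum]; exact Finset.sum_eq_zero fun i _ => h i
    rw [show ∑ i : Fin k, (Pi.single i (1 : ℝ) : Fin k → ℝ) = 1 from
      Finset.univ_sum_single (1 : Fin k → ℝ), map_one] at h2
    exact one_ne_zero h2
  refine ⟨i, fun x hx => ?_⟩
  rw [← hB x hx]
  refine mul_right_cancel₀ hi ?_
  change R x * _ = _
  rw [← map_mul]
  conv_rhs => rw [← hconst (x i)]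
  rw [← map_mul]
  congr 1
  ext j
  by_cases hj : j = i
  · subst hj; simp
  · simp [hj]

/-- If all multiplicative dilations of `φ` scale it by the `i`-th coordinate up to an additive
function, then `φ` is `x i * L x` up to a linear function, with `L` logarithmic. -/
theorem exists_logarithmic_of_dilation {k : ℕ} (i : Fin k) {φ : (Fin k → ℝ) → ℝ}
    (hφ : ContinuousOn φ (posCone k))
    (hlin : ∀ t ∈ posCone k, IsAdditive fun x => φ (t * x) - t i * φ x) :
    ∃ L : (Fin k → ℝ) → ℝ, IsLogarithmic L ∧ ContinuousOn L (posCone k) ∧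
      ∃ d : Fin k → ℝ, ∀ x ∈ posCone k, φ x = x i * L x + ∑ j, d j * x j := by
  have hex : ∀ t ∈ posCone k, ∃ a : Fin k → ℝ, ∀ x ∈ posCone k,
      φ (t * x) - t i * φ x = ∑ j, a j * x j := fun t ht =>
    (hlin t ht).exists_coeff <|
      (hφ.comp (by fun_prop) fun x hx => mul_mem_posCone ht hx).sub (continuousOn_const.mul hφ)
  choose! a ha using hex
  -- Compute φ(stx) by dilating in the two possible orders and compare coefficients of x_j.
  have hrel : ∀ s ∈ posCone k, ∀ t ∈ posCone k, ∀ j,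
      a s j * t j + s i * a t j = a t j * s j + t i * a s j := by
    intro s hs t ht j
    refine coeff_unique_on_posCone (a := fun j => a s j * t j + s i * a t j)
      (b := fun j => a t j * s j + t i * a s j) (fun x hx => ?_) j
    have e1 := ha s hs (t * x) (mul_mem_posCone ht hx)
    have e2 := ha t ht (s * x) (mul_mem_posCone hs hx)
    have e3 := ha s hs x hx
    have e4 := ha t ht x hx
    rw [mul_left_comm s t x] at e1
    simp only [add_mul, Finset.sum_add_distrib, mul_assoc, ← Finset.mul_sum, ← e3, ← e4]
    simp only [Pi.mul_apply] at e1 e2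
    rw [← e1, ← e2]
    ring
  -- Testing the relation on t with t_j = 2 and all other entries 1 gives a_s(j) = d_j(s_j - s_i)
  -- for j ≠ i, exactly the contribution of a term d_j x_j in φ.
  set d₀ : Fin k → ℝ := fun j => if j = i then 0 else a (Function.update 1 j 2) j with hd₀
  have hcoef : ∀ s ∈ posCone k, ∀ j, j ≠ i → a s j = d₀ j * (s j - s i) := by
    intro s hs j hj
    have h := hrel s hs (Function.update 1 j 2) (fun l => by
      by_cases hl : l = j
      · subst hl; simp
      · simp [hl]) j
    simp only [Function.update_self, Function.update_of_ne hj.symm, Pi.one_apply] at h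
    simp only [hd₀, if_neg hj]
    linarith
  -- A multiple of x_i does not affect the dilation defect, so it can be used to normalise ρ(1) = 0;
  -- then ρ(tx) = t_i ρ(x) + ρ(t) x_i.
  set c : ℝ := φ 1 - ∑ j, d₀ j with hc
  set ρ : (Fin k → ℝ) → ℝ := fun x => φ x - ∑ j, d₀ j * x j - c * x i with hρ
  have hρ1 : ρ 1 = 0 := by simp [hρ, hc]
  have hdil : ∀ t ∈ posCone k, ∀ x ∈ posCone k, ρ (t * x) = t i * ρ x + a t i * x i := by
    intro t ht x hx
    have h1 := ha t ht x hx
    have h2 : ∑ j, (a t j - d₀ j * (t j - t i)) * x j = a t i * x i := by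
      rw [Finset.sum_eq_single i]
      · simp
      · intro j _ hj
        rw [hcoef t ht j hj]; ring
      · simp
    have h3 : ∑ j, (a t j - d₀ j * (t j - t i)) * x j
        = ∑ j, a t j * x j - ∑ j, d₀ j * (t j * x j) + t i * ∑ j, d₀ j * x j := by
      rw [Finset.mul_sum, ← Finset.sum_sub_distrib, ← Finset.sum_add_distrib]
      exact Finset.sum_congr rfl fun j _ => by ring
    simp only [hρ, Pi.mul_apply]
    linarith
  have hρa : ∀ t ∈ posCone k, a t i = ρ t := by
    intro t ht
    have := hdil t ht 1 one_mem_posCone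
    rw [mul_one, hρ1] at this
    simp only [Pi.one_apply] at this
    linarith
  refine ⟨fun x => ρ x / x i, ?_, ?_, fun j => d₀ j + if j = i then c else 0, ?_⟩
  · intro x hx y hy
    have hxi := (hx i).ne'
    have hyi := (hy i).ne'
    simp only [hdil x hx y hy, hρa x hx, Pi.mul_apply]
    field_simp
    ring
  · refine ContinuousOn.div ?_ (by fun_prop) fun x hx => (hx i).ne'
    exact (hφ.sub (by fun_prop)).sub (by fun_prop)
  · intro x hx
    have hxi := (hx i).ne'
    simp only [add_mul, Finset.sum_add_distrib, ite_mul, zero_mul, Finset.sum_ite_eq',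
      Finset.mem_univ, if_true]
    rw [mul_div_cancel₀ _ hxi]
    simp only [hρ]
    ring

/-! ### The cocycle of a solution -/

/-- The homogeneous symmetric cocycle attached to a solution of the modified entropy equation. -/
noncomputable def entropyCocycle {k : ℕ} (μ : (Fin k → ℝ) → ℝ)
    (f : (Fin k → ℝ) → (Fin k → ℝ) → (Fin k → ℝ) → ℝ) (x y : Fin k → ℝ) : ℝ :=
  μ (x + y) * f 0 (x / (x + y)) (y / (x + y))

theorem posCone_subset_nonnegCone {k : ℕ} : posCone k ⊆ nonnegCone k := fun _ hx i => (hx i).le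

theorem zero_mem_nonnegCone {k : ℕ} : (0 : Fin k → ℝ) ∈ nonnegCone k := fun _ => le_rfl

theorem mul_div_cancel_posCone {k : ℕ} {s x : Fin k → ℝ} (hs : s ∈ posCone k) :
    s * (x / s) = x := by
  ext i
  exact mul_div_cancel₀ _ (hs i).ne'

theorem div_self_posCone {k : ℕ} {s : Fin k → ℝ} (hs : s ∈ posCone k) : s / s = 1 := by
  ext i
  exact div_self (hs i).ne'

theorem vec_add_div {k : ℕ} (x y s : Fin k → ℝ) : (x + y) / s = x / s + y / s := by
  ext i
  exact add_div _ _ _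

theorem IsMultiplicative.eq_zero_of_one {k : ℕ} {μ : (Fin k → ℝ) → ℝ} (hμ : IsMultiplicative μ)
    (h : μ 1 = 0) {x : Fin k → ℝ} (hx : x ∈ posCone k) : μ x = 0 := by
  have := hμ 1 one_mem_posCone x hx
  rwa [h, one_mul, zero_mul] at this

theorem IsMultiplicative.map_one {k : ℕ} {μ : (Fin k → ℝ) → ℝ} (hμ : IsMultiplicative μ)
    (h : μ 1 ≠ 0) : μ 1 = 1 := by
  have := hμ 1 one_mem_posCone 1 one_mem_posCone
  rw [mul_one] at this
  exact mul_right_cancel₀ h (by rw [one_mul]; exact this.symm)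

section

variable {k : ℕ} {μ : (Fin k → ℝ) → ℝ} {f : (Fin k → ℝ) → (Fin k → ℝ) → (Fin k → ℝ) → ℝ}

theorem IsSymmetric.zero_swap (hf : IsSymmetric f) {x y : Fin k → ℝ} (hx : x ∈ posCone k)
    (hy : y ∈ posCone k) : f 0 x y = f 0 y x :=
  (hf 0 zero_mem_nonnegCone x (posCone_subset_nonnegCone hx) y (posCone_subset_nonnegCone hy)).2

theorem ModifiedEntropyEquation.eq_add_entropyCocycle (hf : IsSymmetric f)
    (heq : ModifiedEntropyEquation μ f) {x y z : Fin k → ℝ} (hx : x ∈ posCone k)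
    (hy : y ∈ posCone k) (hz : z ∈ posCone k) :
    f x y z = f 0 x (y + z) + entropyCocycle μ f y z := by
  have hx' := posCone_subset_nonnegCone hx
  have hw := posCone_subset_nonnegCone (add_mem_posCone hy hz)
  rw [heq x hx y hy z hz, (hf x hx' _ hw 0 zero_mem_nonnegCone).2,
    (hf x hx' 0 zero_mem_nonnegCone _ hw).1, entropyCocycle]

theorem entropyCocycle_mul (hμ : IsMultiplicative μ) {t x y : Fin k → ℝ} (ht : t ∈ posCone k)
    (hx : x ∈ posCone k) (hy : y ∈ posCone k) :
    entropyCocycle μ f (t * x) (t * y) = μ t * entropyCocycle μ f x y := by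
  have h : ∀ u : Fin k → ℝ, t * u / (t * (x + y)) = u / (x + y) := fun u => by
    ext i
    exact mul_div_mul_left _ _ (ht i).ne'
  simp only [entropyCocycle, ← mul_add, h, hμ t ht _ (add_mem_posCone hx hy), mul_assoc]

/-- On x+y+z = 1 both sides equal f(x,y,z), because H(x,y) = f(0,x,y) when x+y = 1 and μ(1) = 1.
Homogeneity carries this to all sums; if μ(1) = 0 then H vanishes. -/
theorem isSymmCocycleOn_entropyCocycle (hμ : IsMultiplicative μ) (hf : IsSymmetric f)
    (heq : ModifiedEntropyEquation μ f) :
    IsSymmCocycleOn (posCone k) (entropyCocycle μ f) := by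
  have hsymm : ∀ x ∈ posCone k, ∀ y ∈ posCone k,
      entropyCocycle μ f x y = entropyCocycle μ f y x := by
    intro x hx y hy
    have h := add_mem_posCone hx hy
    simp only [entropyCocycle]
    rw [hf.zero_swap (div_mem_posCone hx h) (div_mem_posCone hy h), add_comm x y]
  refine ⟨hsymm, ?_⟩
  by_cases h1 : μ 1 = 0
  · intro x hx y hy z hz
    simp only [entropyCocycle,
      hμ.eq_zero_of_one h1 (add_mem_posCone (add_mem_posCone hx hy) hz),
      hμ.eq_zero_of_one h1 (add_mem_posCone hx (add_mem_posCone hy hz)),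
      hμ.eq_zero_of_one h1 (add_mem_posCone hx hy), hμ.eq_zero_of_one h1 (add_mem_posCone hy hz)]
    ring
  have hnorm : ∀ x ∈ posCone k, ∀ y ∈ posCone k, x + y = 1 → f 0 x y = entropyCocycle μ f x y := by
    intro x _ y _ h
    simp [entropyCocycle, h, hμ.map_one h1]
  have hunit : ∀ x ∈ posCone k, ∀ y ∈ posCone k, ∀ z ∈ posCone k, x + y + z = 1 →
      entropyCocycle μ f (x + y) z + entropyCocycle μ f x y
        = entropyCocycle μ f x (y + z) + entropyCocycle μ f y z := by
    intro x hx y hy z hz h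
    have hx' := posCone_subset_nonnegCone hx
    have hy' := posCone_subset_nonnegCone hy
    have hz' := posCone_subset_nonnegCone hz
    have e1 := heq.eq_add_entropyCocycle hf hx hy hz
    have e2 := heq.eq_add_entropyCocycle hf hz hx hy
    rw [hnorm x hx _ (add_mem_posCone hy hz) (by rw [← add_assoc, h])] at e1
    rw [hnorm z hz _ (add_mem_posCone hx hy) (by rw [add_comm, h]),
      hsymm z hz _ (add_mem_posCone hx hy)] at e2
    rw [← e1, ← e2, (hf z hz' x hx' y hy').1, (hf x hx' z hz' y hy').2]
  intro x hx y hy z hz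
  have hs := add_mem_posCone (add_mem_posCone hx hy) hz
  set s := x + y + z with hsdef
  have hx1 := div_mem_posCone hx hs
  have hy1 := div_mem_posCone hy hs
  have hz1 := div_mem_posCone hz hs
  have h := hunit _ hx1 _ hy1 _ hz1 (by
    rw [← vec_add_div, ← vec_add_div, ← hsdef, div_self_posCone hs])
  have hscale : ∀ a ∈ posCone k, ∀ b ∈ posCone k,
      entropyCocycle μ f a b = μ s * entropyCocycle μ f (a / s) (b / s) := by
    intro a ha b hb
    rw [← entropyCocycle_mul hμ hs (div_mem_posCone ha hs) (div_mem_posCone hb hs),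
      mul_div_cancel_posCone hs, mul_div_cancel_posCone hs]
  rw [hscale _ (add_mem_posCone hx hy) _ hz, hscale x hx y hy,
    hscale _ hx _ (add_mem_posCone hy hz), hscale y hy z hz, vec_add_div, vec_add_div, ← mul_add, h,
    mul_add]

/-! ### Recovering f from a potential of its cocycle -/

/-- If the cocycle of `f` is a coboundary, then `f` splits into a sum of one-variable functions. -/
theorem exists_sum_representation (hf : IsSymmetric f) (heq : ModifiedEntropyEquation μ f)
    {w : (Fin k → ℝ) → ℝ}
    (hw : ∀ x ∈ posCone k, ∀ y ∈ posCone k, entropyCocycle μ f x y = coboundary w x y) :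
    ∃ ψ : (Fin k → ℝ) → ℝ,
      (∀ x ∈ posCone k, ∀ y ∈ posCone k, ∀ z ∈ posCone k,
        f x y z = w x + w y + w z + ψ (x + y + z)) ∧
      ∀ x ∈ posCone k, ∀ y ∈ posCone k, f 0 x y = w x + w y + ψ (x + y) := by
  set P : (Fin k → ℝ) → (Fin k → ℝ) → ℝ := fun x r => f 0 x r - w r - w x with hP
  have hfP : ∀ x ∈ posCone k, ∀ y ∈ posCone k, ∀ z ∈ posCone k,
      f x y z = w x + w y + w z + P x (y + z) := by
    intro x hx y hy z hz
    rw [heq.eq_add_entropyCocycle hf hx hy hz, hw y hy z hz]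
    simp only [hP, coboundary]
    ring
  have hswap : ∀ x ∈ posCone k, ∀ y ∈ posCone k, ∀ z ∈ posCone k,
      P x (y + z) = P y (x + z) := by
    intro x hx y hy z hz
    have h1 := hfP x hx y hy z hz
    have h2 := hfP y hy x hx z hz
    rw [(hf x (posCone_subset_nonnegCone hx) y (posCone_subset_nonnegCone hy) z
      (posCone_subset_nonnegCone hz)).1] at h1
    linarith
  have hmove : ∀ x ∈ posCone k, ∀ r ∈ posCone k, ∀ u ∈ posCone k, r - u ∈ posCone k →
      P x r = P u (x + r - u) := by
    intro x hx r _ u hu hru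
    have := hswap x hx u hu _ hru
    rwa [add_sub_cancel, ← add_sub_assoc] at this
  have hconst : ∀ x ∈ posCone k, ∀ r ∈ posCone k,
      P x r = P ((1 / 2 : ℝ) • (x + r)) ((1 / 2 : ℝ) • (x + r)) := by
    intro x hx r hr
    have hh := smul_mem_posCone (s := 1 / 2) (by norm_num) (add_mem_posCone hx hr)
    -- Both (x,r) and the pair of equal halves of x+r can be moved to (u, x+r-u), provided u lies
    -- below r and below (x+r)/2 in every coordinate.
    set u : Fin k → ℝ := fun i => min (r i) ((x i + r i) / 2) / 2 with hu
    have hpos : ∀ i, 0 < min (r i) ((x i + r i) / 2) := fun i =>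
      lt_min (hr i) (by linarith [hx i, hr i])
    rw [hmove x hx r hr u (fun i => half_pos (hpos i)) fun i => ?_,
      hmove _ hh _ hh u (fun i => half_pos (hpos i)) fun i => ?_, ← add_smul]
    · norm_num
    · have h1 := min_le_right (r i) ((x i + r i) / 2)
      simp only [hu, Pi.sub_apply, Pi.smul_apply, Pi.add_apply, smul_eq_mul]
      linarith [hpos i]
    · have h1 := min_le_left (r i) ((x i + r i) / 2)
      simp only [hu, Pi.sub_apply]
      linarith [hpos i]
  refine ⟨fun s => P ((1 / 2 : ℝ) • s) ((1 / 2 : ℝ) • s), fun x hx y hy z hz => ?_,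
    fun x hx y hy => ?_⟩
  · rw [hfP x hx y hy z hz, hconst x hx _ (add_mem_posCone hy hz), add_assoc x y z]
  · have := hconst x hx y hy
    simp only at this ⊢
    rw [← this]
    simp only [hP]
    ring

theorem exists_continuous_sum_representation (hf : IsSymmetric f)
    (heq : ModifiedEntropyEquation μ f)
    (hcont :
      ContinuousOn (fun p : (Fin k → ℝ) × (Fin k → ℝ) × (Fin k → ℝ) => f p.1 p.2.1 p.2.2)
        (posCone k ×ˢ posCone k ×ˢ posCone k) ∨
      ContinuousOn (fun p : (Fin k → ℝ) × (Fin k → ℝ) => f 0 p.1 p.2) (posCone k ×ˢ posCone k))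
    {w : (Fin k → ℝ) → ℝ}
    (hw : ∀ x ∈ posCone k, ∀ y ∈ posCone k, entropyCocycle μ f x y = coboundary w x y)
    (hwc : ContinuousOn w (posCone k)) :
    ∃ ψ : (Fin k → ℝ) → ℝ, ContinuousOn ψ (posCone k) ∧
      ∀ x ∈ posCone k, ∀ y ∈ posCone k, ∀ z ∈ posCone k,
        f x y z = w x + w y + w z + ψ (x + y + z) := by
  obtain ⟨ψ, h3, h2⟩ := exists_sum_representation hf heq hw
  refine ⟨ψ, ?_, h3⟩
  rcases hcont with hc | hc
  · have hm : ∀ s ∈ posCone k, (1 / 3 : ℝ) • s ∈ posCone k := fun s hs =>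
      smul_mem_posCone (by norm_num) hs
    have h1 : ContinuousOn (fun s => f ((1 / 3 : ℝ) • s) ((1 / 3 : ℝ) • s) ((1 / 3 : ℝ) • s)
        - 3 * w ((1 / 3 : ℝ) • s)) (posCone k) :=
      (hc.comp (f := fun s => ((1 / 3 : ℝ) • s, (1 / 3 : ℝ) • s, (1 / 3 : ℝ) • s)) (by fun_prop)
        fun s hs => ⟨hm s hs, hm s hs, hm s hs⟩).sub
        (continuousOn_const.mul (hwc.comp (by fun_prop) hm))
    refine h1.congr fun s hs => ?_
    have h := h3 _ (hm s hs) _ (hm s hs) _ (hm s hs)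
    rw [← add_smul, ← add_smul, show (1 / 3 + 1 / 3 + 1 / 3 : ℝ) = 1 by norm_num, one_smul] at h
    linarith
  · have hm : ∀ s ∈ posCone k, (1 / 2 : ℝ) • s ∈ posCone k := fun s hs =>
      smul_mem_posCone (by norm_num) hs
    have h1 : ContinuousOn (fun s => f 0 ((1 / 2 : ℝ) • s) ((1 / 2 : ℝ) • s)
        - 2 * w ((1 / 2 : ℝ) • s)) (posCone k) :=
      (hc.comp (f := fun s => ((1 / 2 : ℝ) • s, (1 / 2 : ℝ) • s)) (by fun_prop)
        fun s hs => ⟨hm s hs, hm s hs⟩).sub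
        (continuousOn_const.mul (hwc.comp (by fun_prop) hm))
    refine h1.congr fun s hs => ?_
    have h := h2 _ (hm s hs) _ (hm s hs)
    rw [← add_smul, show (1 / 2 + 1 / 2 : ℝ) = 1 by norm_num, one_smul] at h
    linarith

/-! ### Non-additive weights, and continuity -/

/-- A homogeneous symmetric cocycle whose weight `μ` is not additive is a multiple of the
coboundary of `μ`. -/
theorem exists_entropyCocycle_eq_of_not_isAdditive (hμ : IsMultiplicative μ)
    (hf : IsSymmetric f) (heq : ModifiedEntropyEquation μ f) (hna : ¬ IsAdditive μ) :
    ∃ b : ℝ, ∀ x ∈ posCone k, ∀ y ∈ posCone k,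
      entropyCocycle μ f x y = coboundary (fun u => b * μ u) x y := by
  -- By multiplicativity, a failure of additivity at (x,y) is μ(x) times the failure at (1, y/x).
  obtain ⟨s, hs, hne⟩ : ∃ s ∈ posCone k, 1 + μ s - μ (1 + s) ≠ 0 := by
    by_contra! h
    refine hna fun x hx y hy => ?_
    have hd := div_mem_posCone hy hx
    have h1 := h _ hd
    have h2 := hμ x hx _ (add_mem_posCone one_mem_posCone hd)
    have h3 := hμ x hx _ hd
    rw [mul_add, mul_one, mul_div_cancel_posCone hx] at h2
    rw [mul_div_cancel_posCone hx] at h3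
    rw [h2, h3]
    linear_combination -μ x * h1
  set G := entropyCocycle μ f 1 s with hG
  refine ⟨G / (1 + μ s - μ (1 + s)), fun x hx y hy => ?_⟩
  have h := (isSymmCocycleOn_entropyCocycle hμ hf heq).four_term
    (fun x hx y hy => add_mem_posCone hx hy) hx (mul_mem_posCone hs hx) hy (mul_mem_posCone hs hy)
  have hone : ∀ u ∈ posCone k, entropyCocycle μ f u (s * u) = μ u * G := by
    intro u hu
    have := entropyCocycle_mul (f := f) hμ hu one_mem_posCone hs
    rwa [mul_one, mul_comm u s] at this
  have hsum : ∀ u : Fin k → ℝ, u + s * u = (1 + s) * u := fun u => by ring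
  rw [hone x hx, hone y hy, ← mul_add, hone _ (add_mem_posCone hx hy), hsum, hsum,
    entropyCocycle_mul hμ (add_mem_posCone one_mem_posCone hs) hx hy,
    entropyCocycle_mul hμ hs hx hy] at h
  simp only [coboundary]
  field_simp
  linear_combination -h

/-- On pairs (tr, tr') with r+r' = 1 the term χ depends on t only. Subtracting two such pairs leaves
b μ(t) times a constant, which can be chosen nonzero unless μ is additive or identically 1. -/
theorem IsMultiplicative.continuousOn_of_representation (hμ : IsMultiplicative μ)
    (hna : ¬ IsAdditive μ) (hn1 : ¬ ∀ x ∈ posCone k, μ x = 1) {b : ℝ} (hb : b ≠ 0)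
    {F : (Fin k → ℝ) → (Fin k → ℝ) → ℝ} {χ : (Fin k → ℝ) → ℝ}
    (hF : ContinuousOn (fun p : (Fin k → ℝ) × (Fin k → ℝ) => F p.1 p.2)
      (posCone k ×ˢ posCone k))
    (hrep : ∀ x ∈ posCone k, ∀ y ∈ posCone k, F x y = b * (μ x + μ y) + χ (x + y)) :
    ContinuousOn μ (posCone k) := by
  obtain ⟨p, hp, p', hp', q, hq, q', hq', hpp, hqq, hne⟩ :
      ∃ p ∈ posCone k, ∃ p' ∈ posCone k, ∃ q ∈ posCone k, ∃ q' ∈ posCone k,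
        p + p' = 1 ∧ q + q' = 1 ∧ μ p + μ p' - (μ q + μ q') ≠ 0 := by
    by_contra! h
    have hhalf : (1 / 2 : ℝ) • (1 : Fin k → ℝ) ∈ posCone k :=
      smul_mem_posCone (by norm_num) one_mem_posCone
    set c := μ ((1 / 2 : ℝ) • (1 : Fin k → ℝ)) + μ ((1 / 2 : ℝ) • (1 : Fin k → ℝ)) with hc
    have hsum : ∀ x ∈ posCone k, ∀ y ∈ posCone k, μ x + μ y = c * μ (x + y) := by
      intro x hx y hy
      have hs := add_mem_posCone hx hy
      have h1 := h _ (div_mem_posCone hx hs) _ (div_mem_posCone hy hs) _ hhalf _ hhalf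
        (by rw [← vec_add_div, div_self_posCone hs])
        (by rw [← add_smul]; norm_num)
      have h2 := hμ _ hs _ (div_mem_posCone hx hs)
      have h3 := hμ _ hs _ (div_mem_posCone hy hs)
      rw [mul_div_cancel_posCone hs] at h2 h3
      rw [h2, h3]
      linear_combination μ (x + y) * h1
    -- Expanding x+x+z in two ways shows that c = 1, so that μ is additive, or that μ is constant.
    have hkey : ∀ x ∈ posCone k, ∀ z ∈ posCone k, (1 - c) * (μ x - μ z) = 0 := by
      intro x hx z hz
      have e1 := hsum x hx z hz
      have e2 := hsum _ (add_mem_posCone hx hx) z hz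
      have e3 := hsum x hx _ (add_mem_posCone hx hz)
      have e4 := hsum x hx x hx
      rw [← add_assoc] at e3
      linear_combination c * e2 - c * e3 + e4 - e1
    by_cases h1 : c = 1
    · refine hna fun x hx y hy => ?_
      have := hsum x hx y hy
      rw [h1, one_mul] at this
      exact this.symm
    · by_cases h0 : μ 1 = 0
      · refine hna fun x hx y hy => ?_
        rw [hμ.eq_zero_of_one h0 hx, hμ.eq_zero_of_one h0 hy,
          hμ.eq_zero_of_one h0 (add_mem_posCone hx hy), add_zero]
      · refine hn1 fun x hx => ?_
        rcases mul_eq_zero.1 (hkey x hx 1 one_mem_posCone) with h2 | h2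
        · exact absurd (by linarith) h1
        · rw [hμ.map_one h0] at h2
          linarith
  have hray : ∀ r ∈ posCone k, ∀ r' ∈ posCone k,
      ContinuousOn (fun t => F (t * r) (t * r')) (posCone k) := fun r hr r' hr' =>
    hF.comp (f := fun t => (t * r, t * r')) (by fun_prop) fun t ht =>
      ⟨mul_mem_posCone ht hr, mul_mem_posCone ht hr'⟩
  have hval : ∀ t ∈ posCone k, ∀ r ∈ posCone k, ∀ r' ∈ posCone k, r + r' = 1 →
      F (t * r) (t * r') = b * μ t * (μ r + μ r') + χ t := by
    intro t ht r hr r' hr' h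
    rw [hrep _ (mul_mem_posCone ht hr) _ (mul_mem_posCone ht hr'), hμ t ht r hr, hμ t ht r' hr',
      ← mul_add t, h, mul_one]
    ring
  refine (((hray p hp p' hp').sub (hray q hq q' hq')).div_const
    (b * (μ p + μ p' - (μ q + μ q')))).congr fun t ht => ?_
  simp only [Pi.sub_apply, hval t ht p hp p' hp' hpp, hval t ht q hq q' hq' hqq]
  rw [eq_div_iff (mul_ne_zero hb hne)]
  ring

theorem continuousOn_entropyCocycle (hf : IsSymmetric f) (heq : ModifiedEntropyEquation μ f)
    (hcont :
      ContinuousOn (fun p : (Fin k → ℝ) × (Fin k → ℝ) × (Fin k → ℝ) => f p.1 p.2.1 p.2.2)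
        (posCone k ×ˢ posCone k ×ˢ posCone k) ∨
      ContinuousOn (fun p : (Fin k → ℝ) × (Fin k → ℝ) => f 0 p.1 p.2) (posCone k ×ˢ posCone k))
    (h1 : μ 1 = 1) (hμc : ContinuousOn μ (posCone k)) :
    ContinuousOn (fun p : (Fin k → ℝ) × (Fin k → ℝ) => entropyCocycle μ f p.1 p.2)
      (posCone k ×ˢ posCone k) := by
  set N : (Fin k → ℝ) × (Fin k → ℝ) → (Fin k → ℝ) × (Fin k → ℝ) := fun p =>
    (p.1 / (p.1 + p.2), p.2 / (p.1 + p.2)) with hN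
  have hdiv : ∀ g : (Fin k → ℝ) × (Fin k → ℝ) → Fin k → ℝ, Continuous g →
      ContinuousOn (fun p => g p / (p.1 + p.2)) (posCone k ×ˢ posCone k) := by
    intro g hg
    refine continuousOn_pi.2 fun i => ?_
    refine ContinuousOn.div (f := fun p => g p i) (g := fun p => (p.1 + p.2) i) (by fun_prop)
      (by fun_prop) fun p hp => (add_mem_posCone hp.1 hp.2 i).ne'
  have hNc : ContinuousOn N (posCone k ×ˢ posCone k) :=
    (hdiv _ continuous_fst).prodMk (hdiv _ continuous_snd)
  have hNm : ∀ p ∈ posCone k ×ˢ posCone k, N p ∈ posCone k ×ˢ posCone k := fun p hp =>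
    ⟨div_mem_posCone hp.1 (add_mem_posCone hp.1 hp.2),
      div_mem_posCone hp.2 (add_mem_posCone hp.1 hp.2)⟩
  refine (hμc.comp (by fun_prop) fun p hp => add_mem_posCone hp.1 hp.2).mul ?_
  rcases hcont with hc | hc
  -- For x+y = 1 the equation reads f(1,x,y) = f(0,1,1) + f(0,x,y), so continuity on the open cone
  -- passes to the face where the first argument is zero.
  · have h2 : ContinuousOn (fun p => f 1 (N p).1 (N p).2 - f 0 1 1) (posCone k ×ˢ posCone k) :=
      (hc.comp (f := fun p => (1, (N p).1, (N p).2))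
        (continuousOn_const.prodMk hNc) fun p hp =>
          ⟨one_mem_posCone, (hNm p hp).1, (hNm p hp).2⟩).sub continuousOn_const
    refine h2.congr fun p hp => ?_
    have hs : (N p).1 + (N p).2 = 1 := by
      simp only [hN, ← vec_add_div]
      exact div_self_posCone (add_mem_posCone hp.1 hp.2)
    have := heq.eq_add_entropyCocycle hf one_mem_posCone (hNm p hp).1 (hNm p hp).2
    rw [entropyCocycle, hs, h1, div_one, div_one] at this
    simp only [hN] at this ⊢
    linarith
  · exact hc.comp hNc hNm

end

/-! ### The projection and non-additive cases, and the theorem -/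

section

variable {k : ℕ} {μ : (Fin k → ℝ) → ℝ} {f : (Fin k → ℝ) → (Fin k → ℝ) → (Fin k → ℝ) → ℝ}

theorem exists_logarithmic_of_isProjection (hk : 0 < k) (hμ : IsProjection μ)
    (hf : IsSymmetric f) (heq : ModifiedEntropyEquation μ f)
    (hcont :
      ContinuousOn (fun p : (Fin k → ℝ) × (Fin k → ℝ) × (Fin k → ℝ) => f p.1 p.2.1 p.2.2)
        (posCone k ×ˢ posCone k ×ˢ posCone k) ∨
      ContinuousOn (fun p : (Fin k → ℝ) × (Fin k → ℝ) => f 0 p.1 p.2) (posCone k ×ˢ posCone k)) :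
    ContinuousOn μ (posCone k) ∧ ∃ l : (Fin k → ℝ) → ℝ, IsLogarithmic l ∧
      ContinuousOn l (posCone k) ∧ ∀ x ∈ posCone k, ∀ y ∈ posCone k,
        entropyCocycle μ f x y = coboundary (fun u => μ u * l u) x y := by
  rcases hμ.eq_zero_or_eq_coord with h0 | ⟨i, hi⟩
  · refine ⟨continuousOn_const.congr h0, 0, fun _ _ _ _ => by simp, continuousOn_const, ?_⟩
    intro x hx y hy
    simp [entropyCocycle, coboundary, h0 _ (add_mem_posCone hx hy)]
  have hμc : ContinuousOn μ (posCone k) :=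
    (continuous_apply i).continuousOn.congr hi
  obtain ⟨φ, hφ, hφH⟩ := exists_eq_coboundary_posCone hk
    (isSymmCocycleOn_entropyCocycle hμ.2 hf heq)
    (continuousOn_entropyCocycle hf heq hcont (hi 1 one_mem_posCone) hμc)
  obtain ⟨l, hl, hlc, d, hd⟩ := exists_logarithmic_of_dilation i hφ (by
    intro t ht x hx y hy
    have h := entropyCocycle_mul (f := f) hμ.2 ht hx hy
    rw [hφH _ (mul_mem_posCone ht hx) _ (mul_mem_posCone ht hy), hφH x hx y hy, hi t ht] at h
    simp only [coboundary, ← mul_add] at h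
    linear_combination -h)
  refine ⟨hμc, l, hl, hlc, fun x hx y hy => ?_⟩
  have hs := add_mem_posCone hx hy
  rw [hφH x hx y hy]
  simp only [coboundary, hd x hx, hd y hy, hd _ hs, hi x hx, hi y hy, hi _ hs, Pi.add_apply,
    mul_add, Finset.sum_add_distrib]
  ring

theorem exists_continuous_of_not_isAdditive (hμ : IsMultiplicative μ) (hf : IsSymmetric f)
    (heq : ModifiedEntropyEquation μ f)
    (hcont :
      ContinuousOn (fun p : (Fin k → ℝ) × (Fin k → ℝ) × (Fin k → ℝ) => f p.1 p.2.1 p.2.2)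
        (posCone k ×ˢ posCone k ×ˢ posCone k) ∨
      ContinuousOn (fun p : (Fin k → ℝ) × (Fin k → ℝ) => f 0 p.1 p.2) (posCone k ×ˢ posCone k))
    (hna : ¬ IsAdditive μ) :
    ∃ b : ℝ, ContinuousOn (fun u => b * μ u) (posCone k) ∧ ∀ x ∈ posCone k, ∀ y ∈ posCone k,
      entropyCocycle μ f x y = coboundary (fun u => b * μ u) x y := by
  obtain ⟨b, hb⟩ := exists_entropyCocycle_eq_of_not_isAdditive hμ hf heq hna
  refine ⟨b, ?_, hb⟩
  by_cases h0 : b = 0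
  · simp only [h0, zero_mul]
    exact continuousOn_const
  by_cases h1 : ∀ x ∈ posCone k, μ x = 1
  · exact continuousOn_const.mul (continuousOn_const.congr h1)
  obtain ⟨ψ, h3, h2⟩ := exists_sum_representation hf heq hb
  refine continuousOn_const.mul ?_
  rcases hcont with hc | hc
  · refine hμ.continuousOn_of_representation hna h1 h0 (F := f 1)
      (χ := fun s => b * μ 1 + ψ (1 + s))
      (hc.comp (f := fun p : (Fin k → ℝ) × (Fin k → ℝ) => (1, p.1, p.2)) (by fun_prop)
        fun p hp => ⟨one_mem_posCone, hp.1, hp.2⟩) fun x hx y hy => ?_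
    rw [h3 1 one_mem_posCone x hx y hy, add_assoc 1 x y]
    ring
  · refine hμ.continuousOn_of_representation hna h1 h0 (F := f 0) (χ := ψ) hc fun x hx y hy => ?_
    rw [h2 x hx y hy]
    ring

end

end ModifiedEntropy

theorem theorem3p1 (k : ℕ) (hk : 0 < k)
    (μ : (Fin k → ℝ) → ℝ) (hμ : ModifiedEntropy.IsMultiplicative μ)
    (f : (Fin k → ℝ) → (Fin k → ℝ) → (Fin k → ℝ) → ℝ)
    (hsymm : ModifiedEntropy.IsSymmetric f)
    (heq : ModifiedEntropy.ModifiedEntropyEquation μ f)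
    (hcont :
      ContinuousOn (fun p : (Fin k → ℝ) × (Fin k → ℝ) × (Fin k → ℝ) => f p.1 p.2.1 p.2.2)
        (ModifiedEntropy.posCone k ×ˢ ModifiedEntropy.posCone k ×ˢ ModifiedEntropy.posCone k) ∨
      ContinuousOn (fun p : (Fin k → ℝ) × (Fin k → ℝ) => f 0 p.1 p.2)
        (ModifiedEntropy.posCone k ×ˢ ModifiedEntropy.posCone k)) :
    (ModifiedEntropy.IsProjection μ →
      ∃ l ψ₁ : (Fin k → ℝ) → ℝ,
        ModifiedEntropy.IsLogarithmic l ∧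
        ContinuousOn l (ModifiedEntropy.posCone k) ∧
        (∃ c : Fin k → ℝ, ∀ x ∈ ModifiedEntropy.posCone k,
          l x = ∑ i, c i * Real.log (x i)) ∧
        ContinuousOn ψ₁ (ModifiedEntropy.posCone k) ∧
        ∀ x ∈ ModifiedEntropy.posCone k, ∀ y ∈ ModifiedEntropy.posCone k,
          ∀ z ∈ ModifiedEntropy.posCone k,
            f x y z = μ x * l x + μ y * l y + μ z * l z + ψ₁ (x + y + z)) ∧
    ((∀ x ∈ ModifiedEntropy.posCone k, μ x = 1) →
      ∃ ψ₂ : (Fin k → ℝ) → ℝ,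
        ContinuousOn ψ₂ (ModifiedEntropy.posCone k) ∧
        ∀ x ∈ ModifiedEntropy.posCone k, ∀ y ∈ ModifiedEntropy.posCone k,
          ∀ z ∈ ModifiedEntropy.posCone k, f x y z = ψ₂ (x + y + z)) ∧
    (¬ ModifiedEntropy.IsProjection μ → ¬ (∀ x ∈ ModifiedEntropy.posCone k, μ x = 1) →
      ∃ (ψ₃ : (Fin k → ℝ) → ℝ) (b : ℝ),
        ContinuousOn ψ₃ (ModifiedEntropy.posCone k) ∧
        ∀ x ∈ ModifiedEntropy.posCone k, ∀ y ∈ ModifiedEntropy.posCone k,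
          ∀ z ∈ ModifiedEntropy.posCone k,
            f x y z = b * (μ x + μ y + μ z) + ψ₃ (x + y + z)) := by
  refine ⟨fun hp => ?_, fun h1 => ?_, fun hnp _ => ?_⟩
  · obtain ⟨hμc, l, hl, hlc, hH⟩ :=
      ModifiedEntropy.exists_logarithmic_of_isProjection hk hp hsymm heq hcont
    obtain ⟨ψ, hψ, hrep⟩ := ModifiedEntropy.exists_continuous_sum_representation hsymm heq hcont hH
      (hμc.mul hlc)
    exact ⟨l, ψ, hl, hlc, hl.exists_coeff hlc, hψ, hrep⟩
  · have hna : ¬ ModifiedEntropy.IsAdditive μ := fun h => by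
      have hone := ModifiedEntropy.one_mem_posCone (k := k)
      have := h 1 hone 1 hone
      rw [h1 _ (ModifiedEntropy.add_mem_posCone hone hone), h1 1 hone] at this
      norm_num at this
    obtain ⟨b, hbc, hH⟩ :=
      ModifiedEntropy.exists_continuous_of_not_isAdditive hμ hsymm heq hcont hna
    obtain ⟨ψ, hψ, hrep⟩ := ModifiedEntropy.exists_continuous_sum_representation hsymm heq hcont hH
      hbc
    refine ⟨fun s => 3 * b + ψ s, continuousOn_const.add hψ, fun x hx y hy z hz => ?_⟩
    rw [hrep x hx y hy z hz, h1 x hx, h1 y hy, h1 z hz]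
    ring
  · obtain ⟨b, hbc, hH⟩ := ModifiedEntropy.exists_continuous_of_not_isAdditive hμ hsymm heq hcont
      fun h => hnp ⟨h, hμ⟩
    obtain ⟨ψ, hψ, hrep⟩ := ModifiedEntropy.exists_continuous_sum_representation hsymm heq hcont hH
      hbc
    refine ⟨ψ, b, hψ, fun x hx y hy z hz => ?_⟩
    rw [hrep x hx y hy z hz]
    ring
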